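/- Let $\rho=\frac{\sqrt5-1}{2}$ be the inverse of the golden mean, let $\frac12<p<1$, and consider the iterated function system $S_0(x)=\rho x$, $S_1(x)=\rho x+1-\rho$ on $\mathbb{R}$. There is a unique Borel probability measure $\mu$ on $\mathbb{R}$ with $$\mu(E)=p\,\mu(S_0^{-1}(E))+(1-p)\,\mu(S_1^{-1}(E))\quad\text{for all Borel }E\subseteq\mathbb{R}$$ (the biased Bernoulli convolution). For $\delta>0$ let $\overline{\dim}_{\Phi_\delta}\mu\in[0,\infty]$ be the infimum of all real $\alpha$ for which there are $C_1,C_2>0$ such that $$\frac{\mu(B(x,R))}{\mu(B(x,r))}\le C_2\left(\frac Rr\right)^{\alpha}\quad\text{for all }x\in\operatorname{supp}\mu\text{ and all }0<r<R^{1+\delta}\le R\le C_1,\ R<1,$$ with $\inf\emptyset=\infty$, where $B(x,R)$ is the open ball, and let $\dim_{qA}\mu=\lim_{\theta\to1^-}\overline{\dim}_{\Phi_{1/\theta-1}}\mu$ be the (upper) quasi-Assouad dimension of $\mu$. Then: 1. $\mu$ is an equicontractive self-similar measure of finite type, that is, both maps have the form $x\mapsto \rho x+d$, and there is a finite set $F\subseteq\mathbb{R}$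 such that, for all $n\ge 0$ and all words $v,w$ of length $n$ on $\{0,1\}$, either $|S_v(0)-S_w(0)|>c\rho^n$ or $\rho^{-n}|S_v(0)-S_w(0)|\in F$, where $S_w=S_{j_1}\circ\cdots\circ S_{j_n}$ for $w=(j_1,\dots,j_n)$ and $c$ is the diameter of the self-similar set (the non-empty compact $K$ with $K=S_0(K)\cup S_1(K)$); 2. $\operatorname{supp}\mu=[0,1]$; 3. for every $\delta>0$, $$\frac{\log\left(p/(1-p)\right)}{2\delta|\log\rho|}\le\overline{\dim}_{\Phi_\delta}\mu<\infty;$$ 4. nevertheless $\dim_{qA}\mu=\infty$. -/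

import Mathlib

open Set Filter Topology MeasureTheory

noncomputable section

namespace BernoulliConv

section Dimensions

/-- A dimension function: a map `Φ : (0,1) → [0,∞)` such that `x ^ (1 + Φ x)` decreases to `0`
as `x` decreases to `0`.  (Only the values of `Φ` on `(0,1)` matter.) -/
structure IsDimensionFunction (Φ : ℝ → ℝ) : Prop where
  nonneg : ∀ x ∈ Ioo (0 : ℝ) 1, 0 ≤ Φ x
  mono : MonotoneOn (fun x => x ^ (1 + Φ x)) (Ioo (0 : ℝ) 1)
  tendsto : Tendsto (fun x => x ^ (1 + Φ x)) (𝓝[>] (0 : ℝ)) (𝓝 0)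

/-- Non-negative constants are dimension functions. -/
theorem isDimensionFunction_const {δ : ℝ} (hδ : 0 ≤ δ) : IsDimensionFunction (fun _ => δ) where
  nonneg := fun _ _ => hδ
  mono := fun _ hx _ _ hxy => Real.rpow_le_rpow hx.1.le hxy (by linarith)
  tendsto := by
    have h : ContinuousAt (fun x : ℝ => x ^ (1 + δ)) 0 :=
      Real.continuousAt_rpow_const _ _ (Or.inr (by linarith))
    have h' := h.tendsto
    rw [Real.zero_rpow (by linarith)] at h'
    exact h'.mono_left nhdsWithin_le_nhds

variable {X : Type*} [PseudoMetricSpace X] [MeasurableSpace X]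

/-- The set of exponents `α` for which there are `C₁, C₂ > 0` such that
`μ(B(x,R)) / μ(B(x,r)) ≤ C₂ (R/r)^α` for all `x ∈ supp μ` and all
`0 < r < R^(1+Φ(R)) ≤ R ≤ C₁` (with `R` in the domain `(0,1)` of `Φ`). -/
def upperPhiExponents (Φ : ℝ → ℝ) (μ : Measure X) : Set ℝ :=
  {α | ∃ C₁ > (0 : ℝ), ∃ C₂ > (0 : ℝ), ∀ R ∈ Ioo (0 : ℝ) 1, ∀ r : ℝ,
    0 < r → r < R ^ (1 + Φ R) → R ^ (1 + Φ R) ≤ R → R ≤ C₁ →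
      ∀ x ∈ μ.support,
        μ.real (Metric.ball x R) / μ.real (Metric.ball x r) ≤ C₂ * (R / r) ^ α}

/-- The upper `Φ`-dimension of a (Borel probability) measure; it is `⊤` if there is no
admissible exponent. -/
def upperPhiDim (Φ : ℝ → ℝ) (μ : Measure X) : EReal :=
  sInf ((fun α : ℝ => (α : EReal)) '' upperPhiExponents Φ μ)

/-- `d` is the (upper) quasi-Assouad dimension of `μ`: the limit as `θ → 1` from below of the
upper `Φ_θ`-dimensions, where `Φ_θ` is the constant function `1/θ - 1`. -/
def HasQuasiAssouadDim (μ : Measure X) (d : EReal) : Prop :=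
  Tendsto (fun θ : ℝ => upperPhiDim (fun _ => 1 / θ - 1) μ) (𝓝[<] (1 : ℝ)) (𝓝 d)

end Dimensions

section SelfSimilar

variable {ι : Type*} [Fintype ι]

/-- `μ` is a self-similar measure of the iterated function system `S` of contracting similarities
of the real line with (positive) probabilities `P`. -/
structure IsSelfSimilarMeasure (S : ι → ℝ → ℝ) (P : ι → ℝ) (μ : Measure ℝ) : Prop where
  similarity : ∀ j, ∃ r ∈ Ioo (0 : ℝ) 1, ∀ x y, dist (S j x) (S j y) = r * dist x y
  prob_pos : ∀ j, 0 < P j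
  prob_sum : ∑ j, P j = 1
  isProbabilityMeasure : IsProbabilityMeasure μ
  invariant : ∀ E : Set ℝ, MeasurableSet E → μ E = ∑ j, ENNReal.ofReal (P j) * μ (S j ⁻¹' E)

/-- The maps of `S` are similarities `x ↦ r x + d` with the common factor `r ∈ (0,1)`. -/
def IsEquicontractive (S : ι → ℝ → ℝ) (r : ℝ) : Prop :=
  r ∈ Ioo (0 : ℝ) 1 ∧ ∀ j, ∃ d : ℝ, ∀ x, S j x = r * x + d

/-- `K` is the self-similar set of `S`. -/
def IsSelfSimilarSet (S : ι → ℝ → ℝ) (K : Set ℝ) : Prop :=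
  K.Nonempty ∧ IsCompact K ∧ K = ⋃ j, S j '' K

/-- The map `S_w = S_{j₁} ∘ ⋯ ∘ S_{jₙ}` of a word `w = (j₁, …, jₙ)`. -/
def wordMap (S : ι → ℝ → ℝ) (w : List ι) : ℝ → ℝ :=
  w.foldr (fun j f => S j ∘ f) id

/-- The equicontractive system `S` with contraction factor `r` is of finite type: there is a
finite set `F` such that for words `v, w` of length `n`, either
`|S_v(0) - S_w(0)| > c r^n` or `r^{-n} |S_v(0) - S_w(0)| ∈ F`, where `c` is the diameter of the
self-similar set. -/
def IsFiniteType (S : ι → ℝ → ℝ) (r : ℝ) : Prop :=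
  IsEquicontractive S r ∧ ∃ K : Set ℝ, IsSelfSimilarSet S K ∧
    ∃ F : Set ℝ, F.Finite ∧ ∀ (n : ℕ) (v w : List ι), v.length = n → w.length = n →
      Metric.diam K * r ^ n < |wordMap S v 0 - wordMap S w 0| ∨
        (r ^ n)⁻¹ * |wordMap S v 0 - wordMap S w 0| ∈ F

end SelfSimilar

/-- The inverse of the golden mean. -/
def rho : ℝ := Real.goldenRatio⁻¹

/-- The iterated function system `{ρ x, ρ x + 1 - ρ}`. -/
def goldenIFS : Fin 2 → ℝ → ℝ :=
  ![fun x => rho * x, fun x => rho * x + 1 - rho]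

/-- The probabilities `p, 1 - p`. -/
def biasedProb (p : ℝ) : Fin 2 → ℝ := ![p, 1 - p]

end BernoulliConv

end

namespace BernoulliConv

/-! The argument turns on the point `ρ² = 1 - ρ`, where `μ` is very lopsided. It equals `S₁(0)`, so
an interval of length `ρ^(2m+1)` to its right has mass at least `(1-p) p^(2m)`. Its left side is out
of reach of `S₁`; since `ρ² = S₀S₀(1)` and `ρ²` is the fixed point of `S₀S₁`, the mass there
satisfies a recursion with factor `p(1-p)` and a forcing term of order `(1-p)^(2m)`. As `p > 1/2`,
the factor dominates and the left mass is `O((p(1-p))^m)` (`exists_real_Ioo_rho_sq_le`).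

A ball of radius `R ≈ ρ^(2m)` centred just left of `ρ²` sees the right side, while one of radius `r
≈ R^(1+δ)` does not. So the mass ratio is at least of order `(p/(1-p))^m`, whereas `R/r` is only of
order `ρ^(-2δm)`; this gives the lower bound (`le_upperPhiDim`), which blows up as `δ → 0`.
Finiteness for fixed `δ` needs only a power lower bound for masses of balls (`pow_le_real_ball`),
because `r < R^(1+δ)` makes `R/r` at least a fixed power of `1/r`.

Finite type is the Pisot property: normalized differences lie in a fixed multiple of `ℤ[φ]` and have
bounded conjugates (`exists_wordMap_sub_eq`). -/

lemma rho_pos : 0 < rho := inv_pos.2 Real.goldenRatio_pos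

lemma rho_sq : rho ^ 2 = 1 - rho := by
  have h : rho = -Real.goldenConj := Real.inv_goldenRatio
  have := Real.goldenConj_sq
  rw [h]; linarith

lemma rho_lt_one : rho < 1 := by nlinarith [rho_sq, rho_pos]

lemma half_lt_rho : 1 / 2 < rho := by nlinarith [rho_sq, rho_pos]

@[simp] lemma goldenIFS_zero (x : ℝ) : goldenIFS 0 x = rho * x := rfl

@[simp] lemma goldenIFS_one (x : ℝ) : goldenIFS 1 x = rho * x + 1 - rho := rfl

lemma goldenIFS_apply (j : Fin 2) (x : ℝ) :
    goldenIFS j x = rho * x + (1 - rho) * ((j : ℕ) : ℝ) := by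
  fin_cases j <;> simp; ring

lemma continuous_goldenIFS (j : Fin 2) : Continuous (goldenIFS j) := by
  have : goldenIFS j = fun x => rho * x + (1 - rho) * ((j : ℕ) : ℝ) :=
    funext (goldenIFS_apply j)
  rw [this]; fun_prop

lemma measurable_goldenIFS (j : Fin 2) : Measurable (goldenIFS j) :=
  (continuous_goldenIFS j).measurable

lemma isEquicontractive_goldenIFS : IsEquicontractive goldenIFS rho :=
  ⟨⟨rho_pos, rho_lt_one⟩, fun j => ⟨_, goldenIFS_apply j⟩⟩

/-! ### Uniqueness of the self-similar measure, by characteristic functions -/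

section Uniqueness

variable {p : ℝ} {μ ν : Measure ℝ}

lemma IsSelfSimilarMeasure.eq_sum_map (h : IsSelfSimilarMeasure goldenIFS (biasedProb p) μ) :
    μ = ENNReal.ofReal p • μ.map (goldenIFS 0) + ENNReal.ofReal (1 - p) • μ.map (goldenIFS 1) := by
  ext E hE
  rw [h.invariant E hE, Fin.sum_univ_two]
  simp [Measure.map_apply (measurable_goldenIFS _) hE, biasedProb]

lemma charFun_map_goldenIFS_zero (t : ℝ) :
    charFun (μ.map (goldenIFS 0)) t = charFun μ (rho * t) :=
  charFun_map_mul rho t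

lemma charFun_map_goldenIFS_one (t : ℝ) :
    charFun (μ.map (goldenIFS 1)) t =
      charFun μ (rho * t) * Complex.exp (((1 - rho) * t : ℝ) * Complex.I) := by
  have h : goldenIFS 1 = (fun x => x + (1 - rho)) ∘ (rho * ·) := by
    ext x; simp; ring
  rw [h, ← Measure.map_map (by fun_prop) (by fun_prop), charFun_map_add_const, charFun_map_mul]
  simp [mul_comm]

lemma charFun_ofReal_smul_add {a b : ℝ} (ha : 0 ≤ a) (hb : 0 ≤ b) [IsFiniteMeasure μ]
    [IsFiniteMeasure ν] (t : ℝ) :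
    charFun (ENNReal.ofReal a • μ + ENNReal.ofReal b • ν) t
      = a * charFun μ t + b * charFun ν t := by
  simp only [charFun_eq_integral_innerProbChar]
  rw [integral_add_measure, integral_smul_measure, integral_smul_measure,
    ENNReal.toReal_ofReal ha, ENNReal.toReal_ofReal hb]
  · simp
  · exact (BoundedContinuousFunction.integrable μ _).smul_measure ENNReal.ofReal_ne_top
  · exact (BoundedContinuousFunction.integrable ν _).smul_measure ENNReal.ofReal_ne_top

lemma IsSelfSimilarMeasure.charFun_eq (h : IsSelfSimilarMeasure goldenIFS (biasedProb p) μ)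
    (hp0 : 0 ≤ p) (hp1 : p ≤ 1) (t : ℝ) :
    charFun μ t = (p + (1 - p : ℝ) * Complex.exp (((1 - rho) * t : ℝ) * Complex.I))
      * charFun μ (rho * t) := by
  have := h.isProbabilityMeasure
  conv_lhs => rw [h.eq_sum_map]
  rw [charFun_ofReal_smul_add hp0 (by linarith), charFun_map_goldenIFS_zero,
    charFun_map_goldenIFS_one]
  ring

/-- Both characteristic functions satisfy the same functional equation, with a multiplier of modulus
at most 1. Their difference at `t` is thus bounded by that at `ρⁿ t`, which tends to its value 0 at
the origin. -/
theorem IsSelfSimilarMeasure.unique (hp0 : 0 ≤ p) (hp1 : p ≤ 1)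
    (hμ : IsSelfSimilarMeasure goldenIFS (biasedProb p) μ)
    (hν : IsSelfSimilarMeasure goldenIFS (biasedProb p) ν) : μ = ν := by
  have := hμ.isProbabilityMeasure
  have := hν.isProbabilityMeasure
  refine Measure.ext_of_charFun (funext fun t => ?_)
  set d : ℝ → ℂ := fun t => charFun μ t - charFun ν t with hd
  have step (t : ℝ) : ‖d t‖ ≤ ‖d (rho * t)‖ := by
    have h1 : ‖(p + (1 - p : ℝ) * Complex.exp (((1 - rho) * t : ℝ) * Complex.I) : ℂ)‖ ≤ 1 := by
      refine (norm_add_le _ _).trans ?_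
      rw [norm_mul, Complex.norm_exp_ofReal_mul_I, Complex.norm_real, Complex.norm_real,
        Real.norm_of_nonneg hp0, Real.norm_of_nonneg (by linarith)]
      linarith
    simp only [hd]
    rw [hμ.charFun_eq hp0 hp1 t, hν.charFun_eq hp0 hp1 t, ← mul_sub, norm_mul]
    exact mul_le_of_le_one_left (norm_nonneg _) h1
  have iter (n : ℕ) : ‖d t‖ ≤ ‖d (rho ^ n * t)‖ := by
    induction n with
    | zero => simp
    | succ n ih => exact ih.trans ((step _).trans_eq (by rw [pow_succ']; ring_nf))
  have hc : Continuous d := continuous_charFun.sub continuous_charFun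
  have h0 : d 0 = 0 := by simp [hd]
  have hlim : Tendsto (fun n : ℕ => ‖d (rho ^ n * t)‖) atTop (𝓝 0) := by
    have h1 : Tendsto (fun n : ℕ => rho ^ n * t) atTop (𝓝 0) := by
      simpa using (tendsto_pow_atTop_nhds_zero_of_lt_one rho_pos.le rho_lt_one).mul_const t
    have h2 := (hc.norm.tendsto 0).comp h1
    simpa [h0, Function.comp_def] using h2
  have : ‖d t‖ ≤ 0 := ge_of_tendsto' hlim iter
  exact sub_eq_zero.1 (norm_le_zero_iff.1 this)

end Uniqueness

/-! ### Existence, as the law of a random expansion in powers of `ρ` -/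

section Existence

/-- The sequence `j, ω₀, ω₁, …`. -/
def seqCons {α : Type*} (j : α) (ω : ℕ → α) : ℕ → α := fun n => Nat.casesOn n j ω

@[simp] lemma seqCons_zero {α : Type*} (j : α) (ω : ℕ → α) : seqCons j ω 0 = j := rfl

@[simp] lemma seqCons_succ {α : Type*} (j : α) (ω : ℕ → α) (n : ℕ) :
    seqCons j ω (n + 1) = ω n := rfl

lemma measurable_seqCons {α : Type*} [MeasurableSpace α] (j : α) :
    Measurable (seqCons j : (ℕ → α) → ℕ → α) := by
  refine measurable_pi_lambda _ fun n => ?_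
  cases n with
  | zero => exact measurable_const
  | succ n => exact measurable_pi_apply n

/-- Choosing the first term of an i.i.d. sequence first, and then the remaining ones. -/
lemma sum_smul_map_seqCons_infinitePi {ι : Type*} [Fintype ι] [MeasurableSpace ι]
    [MeasurableSingletonClass ι] (ν : Measure ι) [IsProbabilityMeasure ν] :
    ∑ j, ν {j} • (Measure.infinitePi fun _ : ℕ => ν).map (seqCons j)
      = Measure.infinitePi fun _ : ℕ => ν := by
  classical
  refine Measure.eq_infinitePi _ fun s t ht => ?_
  -- Enlarging the index set to a nonempty initial segment lets the coordinate 0 split off and the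
  -- others shift down by one.
  obtain ⟨N, hN⟩ : ∃ N, s ⊆ Finset.range (N + 1) :=
    ⟨s.sup id, fun i hi => Finset.mem_range.2 (Nat.lt_succ_of_le (Finset.le_sup (f := id) hi))⟩
  set t' : ℕ → Set ι := fun i => if i ∈ s then t i else univ with ht'
  have mt' : ∀ i, MeasurableSet (t' i) := fun i => by
    simp only [ht']; split_ifs
    exacts [ht i, MeasurableSet.univ]
  have hpi : Set.pi (s : Set ℕ) t = Set.pi (Finset.range (N + 1) : Set ℕ) t' := by
    ext ω
    simp only [Set.mem_pi, Finset.mem_coe, ht']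
    refine ⟨fun h i _ => ?_, fun h i hi => by simpa [hi] using h i (hN hi)⟩
    split_ifs with hi
    exacts [h i hi, mem_univ _]
  have hprod : ∏ i ∈ s, ν (t i) = ∏ i ∈ Finset.range (N + 1), ν (t' i) := by
    rw [← Finset.prod_subset hN (f := fun i => ν (t' i)) fun i _ hi => by simp [ht', hi]]
    exact Finset.prod_congr rfl fun i hi => by simp [ht', hi]
  have hpre (j : ι) : seqCons j ⁻¹' Set.pi (Finset.range (N + 1) : Set ℕ) t'
      = if j ∈ t' 0 then Set.pi (Finset.range N : Set ℕ) (fun i => t' (i + 1)) else ∅ := by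
    ext ω
    split_ifs with hj
    · simp only [mem_preimage, Set.mem_pi, Finset.mem_coe, Finset.mem_range]
      refine ⟨fun h i hi => h (i + 1) (by omega), fun h i hi => ?_⟩
      cases i with
      | zero => exact hj
      | succ i => exact h i (by omega)
    · simp only [mem_preimage, Set.mem_pi, Finset.mem_coe, Finset.mem_range, mem_empty_iff_false,
        iff_false]
      exact fun h => hj (h 0 (by omega))
  rw [hpi, hprod, Finset.prod_range_succ']
  have hm : MeasurableSet (Set.pi (Finset.range (N + 1) : Set ℕ) t') :=
    MeasurableSet.pi (Finset.countable_toSet _) fun i _ => mt' i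
  simp only [Measure.coe_finsetSum, Finset.sum_apply, Measure.smul_apply, smul_eq_mul,
    Measure.map_apply (measurable_seqCons _) hm, hpre]
  have hval (j : ι) : (Measure.infinitePi fun _ : ℕ => ν)
      (if j ∈ t' 0 then Set.pi (Finset.range N : Set ℕ) (fun i => t' (i + 1)) else ∅)
      = if j ∈ t' 0 then ∏ i ∈ Finset.range N, ν (t' (i + 1)) else 0 := by
    split_ifs
    · exact Measure.infinitePi_pi _ fun i _ => mt' (i + 1)
    · exact measure_empty
  simp only [hval, mul_ite, mul_zero]
  rw [← Finset.sum_filter, ← Finset.sum_mul, mul_comm]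
  congr 1
  rw [sum_measure_singleton]
  simp

/-- The value of the expansion `∑ (1 - ρ) ρⁿ ωₙ`. -/
noncomputable def goldenExpansion (ω : ℕ → Fin 2) : ℝ :=
  ∑' n, (1 - rho) * rho ^ n * ((ω n : ℕ) : ℝ)

lemma summable_goldenExpansion (ω : ℕ → Fin 2) :
    Summable fun n => (1 - rho) * rho ^ n * ((ω n : ℕ) : ℝ) := by
  have h1 : 0 < 1 - rho := sub_pos.2 rho_lt_one
  have hg := (summable_geometric_of_lt_one rho_pos.le rho_lt_one).mul_left (1 - rho)
  refine Summable.of_nonneg_of_le (fun n => ?_) (fun n => ?_) hg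
  · exact mul_nonneg (mul_pos h1 (pow_pos rho_pos n)).le (Nat.cast_nonneg _)
  · have h2 : ((ω n : ℕ) : ℝ) ≤ 1 := by
      have : (ω n : ℕ) ≤ 1 := by omega
      exact_mod_cast this
    have h3 : 0 ≤ (1 - rho) * rho ^ n := (mul_pos h1 (pow_pos rho_pos n)).le
    exact mul_le_of_le_one_right h3 h2

lemma measurable_goldenExpansion : Measurable goldenExpansion := by
  have hlim : Tendsto (fun n ω => ∑ i ∈ Finset.range n, (1 - rho) * rho ^ i * ((ω i : ℕ) : ℝ)) atTop
      (𝓝 goldenExpansion) := by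
    refine tendsto_pi_nhds.2 fun ω => ?_
    exact (summable_goldenExpansion ω).tendsto_sum_tsum_nat
  refine measurable_of_tendsto_metrizable (fun n => ?_) hlim
  refine Finset.measurable_sum _ fun i _ => Measurable.const_mul ?_ _
  have hj : Measurable fun j : Fin 2 => ((j : ℕ) : ℝ) := measurable_of_countable _
  exact hj.comp (measurable_pi_apply i)

lemma goldenExpansion_seqCons (j : Fin 2) (ω : ℕ → Fin 2) :
    goldenExpansion (seqCons j ω) = goldenIFS j (goldenExpansion ω) := by
  rw [goldenExpansion, (summable_goldenExpansion _).tsum_eq_zero_add, goldenIFS_apply,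
    goldenExpansion, ← tsum_mul_left]
  simp only [seqCons_zero, seqCons_succ, pow_succ, pow_zero]
  rw [add_comm]
  congr 1
  · exact tsum_congr fun n => by ring
  · ring

variable {p : ℝ}

theorem exists_isSelfSimilarMeasure (hp0 : 0 < p) (hp1 : p < 1) :
    ∃ μ : Measure ℝ, IsSelfSimilarMeasure goldenIFS (biasedProb p) μ := by
  have hq : 0 < 1 - p := sub_pos.2 hp1
  have hpos : ∀ j, 0 < biasedProb p j := fun j => by fin_cases j <;> simpa [biasedProb]
  have hsum : ∑ j, biasedProb p j = 1 := by simp [biasedProb, Fin.sum_univ_two]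
  set ν : Measure (Fin 2) := ∑ j, ENNReal.ofReal (biasedProb p j) • Measure.dirac j with hν
  have hνj (j : Fin 2) : ν {j} = ENNReal.ofReal (biasedProb p j) := by
    fin_cases j <;> simp [hν, Fin.sum_univ_two]
  have : IsProbabilityMeasure ν := ⟨by
    simp only [hν, Measure.coe_finsetSum, Finset.sum_apply, Measure.smul_apply, measure_univ,
      smul_eq_mul, mul_one]
    rw [← ENNReal.ofReal_sum_of_nonneg fun j _ => (hpos j).le, hsum, ENNReal.ofReal_one]⟩
  refine ⟨(Measure.infinitePi fun _ : ℕ => ν).map goldenExpansion, ?_, hpos, hsum,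
    Measure.isProbabilityMeasure_map measurable_goldenExpansion.aemeasurable, fun E hE => ?_⟩
  · refine fun j => ⟨rho, ⟨rho_pos, rho_lt_one⟩, fun x y => ?_⟩
    rw [goldenIFS_apply, goldenIFS_apply, Real.dist_eq, Real.dist_eq, add_sub_add_right_eq_sub,
      ← mul_sub, abs_mul, abs_of_pos rho_pos]
  · have hE' := measurable_goldenExpansion hE
    rw [Measure.map_apply measurable_goldenExpansion hE]
    conv_lhs => rw [← sum_smul_map_seqCons_infinitePi ν]
    simp only [Measure.coe_finsetSum, Finset.sum_apply, Measure.smul_apply, smul_eq_mul,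
      Measure.map_apply (measurable_seqCons _) hE', hνj]
    refine Finset.sum_congr rfl fun j _ => ?_
    rw [Measure.map_apply measurable_goldenExpansion (measurable_goldenIFS j hE)]
    congr 2
    ext ω
    simp [goldenExpansion_seqCons]

end Existence

/-! ### The self-similar set and the finite type property -/

section FiniteType

lemma isSelfSimilarSet_goldenIFS : IsSelfSimilarSet goldenIFS (Icc 0 1) := by
  have hρ := rho_pos
  have hρ1 := rho_lt_one
  have hρ2 := half_lt_rho
  refine ⟨⟨0, by simp⟩, isCompact_Icc, Subset.antisymm (fun x hx => ?_) ?_⟩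
  · rw [mem_iUnion]
    rcases le_total x rho with h | h
    · exact ⟨0, x / rho, ⟨div_nonneg hx.1 hρ.le, (div_le_one hρ).2 h⟩, by simp; field_simp⟩
    · refine ⟨1, (x - (1 - rho)) / rho, ⟨div_nonneg (by linarith) hρ.le, (div_le_one hρ).2 ?_⟩, ?_⟩
      · linarith [hx.2]
      · simp; field_simp; ring
  · simp only [iUnion_subset_iff, image_subset_iff]
    intro j x hx
    rw [mem_preimage]
    fin_cases j
    · exact ⟨mul_nonneg hρ.le hx.1, mul_le_one₀ hρ1.le hx.1 hx.2⟩
    · simp only [Fin.mk_one, goldenIFS_one]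
      constructor <;> nlinarith [hx.1, hx.2]

lemma goldenConj_eq : Real.goldenConj = -rho := by
  rw [rho, Real.inv_goldenRatio, neg_neg]

lemma goldenRatio_eq : Real.goldenRatio = 1 + rho := by
  have := Real.goldenRatio_add_goldenConj
  rw [goldenConj_eq] at this
  linarith

/-- The normalized differences of the points `S_v(0)` are algebraic integers with bounded
conjugates. -/
lemma exists_wordMap_sub_eq (n : ℕ) (v w : List (Fin 2)) (hv : v.length = n) (hw : w.length = n) :
    ∃ a b : ℤ, wordMap goldenIFS v 0 - wordMap goldenIFS w 0
        = (1 - rho) * rho ^ n * (a + b * Real.goldenRatio) ∧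
      |a + b * Real.goldenConj| ≤ (1 + rho) * (1 - rho ^ n) := by
  induction n generalizing v w with
  | zero =>
    rw [List.length_eq_zero_iff] at hv hw
    exact ⟨0, 0, by simp [hv, hw], by simp⟩
  | succ n ih =>
    obtain ⟨j, v, rfl⟩ := List.exists_cons_of_length_eq_add_one hv
    obtain ⟨k, w, rfl⟩ := List.exists_cons_of_length_eq_add_one hw
    obtain ⟨a, b, h1, h2⟩ := ih v w (by simpa using hv) (by simpa using hw)
    have hvj (j : Fin 2) (v : List (Fin 2)) : wordMap goldenIFS (j :: v) 0
        = rho * wordMap goldenIFS v 0 + (1 - rho) * ((j : ℕ) : ℝ) := by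
      rw [← goldenIFS_apply]; rfl
    set e : ℤ := (j : ℕ) - (k : ℕ) with he
    have he1 : |(e : ℝ)| ≤ 1 := by
      have : |e| ≤ 1 := abs_le.2 ⟨by omega, by omega⟩
      exact_mod_cast this
    have heq : (e : ℝ) = ((j : ℕ) : ℝ) - ((k : ℕ) : ℝ) := by simp [he]
    have hφ := Real.goldenRatio_mul_fib_succ_add_fib n
    have hψ := Real.goldenConj_mul_fib_succ_add_fib n
    have hinv : rho ^ (n + 1) * Real.goldenRatio ^ (n + 1) = 1 := by
      rw [← mul_pow, rho, inv_mul_cancel₀ Real.goldenRatio_ne_zero, one_pow]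
    -- Prepending letters adds `e φ^(n+1) = e (F_n + F_(n+1) φ)` to the normalized difference. The
    -- conjugate changes by at most `ρ^(n+1)`, and these geometric terms sum to the stated bound.
    refine ⟨a + e * Nat.fib n, b + e * Nat.fib (n + 1), ?_, ?_⟩
    · rw [hvj, hvj]
      push_cast
      have : (a + e * (Nat.fib n : ℝ)) + (b + e * (Nat.fib (n + 1) : ℝ)) * Real.goldenRatio
          = (a + b * Real.goldenRatio) + e * Real.goldenRatio ^ (n + 1) := by
        rw [← hφ]; ring
      rw [this, mul_add]
      linear_combination rho * h1 - (1 - rho) * heq - (1 - rho) * e * hinv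
    · push_cast
      have : (a + e * (Nat.fib n : ℝ)) + (b + e * (Nat.fib (n + 1) : ℝ)) * Real.goldenConj
          = (a + b * Real.goldenConj) + e * Real.goldenConj ^ (n + 1) := by
        rw [← hψ]; ring
      rw [this]
      have h3 : |(e : ℝ) * Real.goldenConj ^ (n + 1)| ≤ rho ^ (n + 1) := by
        rw [abs_mul, abs_pow, goldenConj_eq, abs_neg, abs_of_pos rho_pos]
        exact mul_le_of_le_one_left (pow_pos rho_pos _).le he1
      refine (abs_add_le _ _).trans ((add_le_add h2 h3).trans_eq ?_)
      linear_combination rho ^ n * rho_sq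

theorem isFiniteType_goldenIFS : IsFiniteType goldenIFS rho := by
  refine ⟨isEquicontractive_goldenIFS, Icc 0 1, isSelfSimilarSet_goldenIFS,
    (fun x : ℤ × ℤ => |(1 - rho) * (x.1 + x.2 * Real.goldenRatio)|) ''
      (Icc (-10) 10 ×ˢ Icc (-10) 10),
    ((finite_Icc _ _).prod (finite_Icc _ _)).image _, fun n v w hv hw => ?_⟩
  rw [Real.diam_Icc zero_le_one, sub_zero, one_mul, or_iff_not_imp_left, not_lt]
  intro hle
  obtain ⟨a, b, h1, h2⟩ := exists_wordMap_sub_eq n v w hv hw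
  have hρ := rho_pos
  have hρ1 := rho_lt_one
  have hρ2 := half_lt_rho
  have hn := pow_pos rho_pos n
  have hab : (rho ^ n)⁻¹ * |wordMap goldenIFS v 0 - wordMap goldenIFS w 0|
      = |(1 - rho) * (a + b * Real.goldenRatio)| := by
    rw [h1, mul_right_comm, mul_comm _ (rho ^ n), abs_mul (rho ^ n), abs_of_pos hn,
      inv_mul_cancel_left₀ hn.ne']
  have h3 : |(1 - rho) * (a + b * Real.goldenRatio)| ≤ 1 := by
    rw [← hab, inv_mul_le_iff₀ hn, mul_one]
    exact hle
  -- Bounds on an element of `ℤ[φ]` and on its conjugate confine the integers `a`, `b`; subtracting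
  -- the two eliminates `a`.
  have h4 : |(a : ℝ) + b * (1 + rho)| ≤ 4 := by
    rw [abs_mul, abs_of_pos (sub_pos.2 hρ1), ← rho_sq, goldenRatio_eq] at h3
    nlinarith [abs_nonneg ((a : ℝ) + b * (1 + rho))]
  have h5 : |(a : ℝ) + b * (-rho)| ≤ 2 := by
    rw [goldenConj_eq] at h2
    nlinarith
  rw [abs_le] at h4 h5
  have hb1 : (b : ℝ) * (1 + 2 * rho) ≤ 6 := by linarith
  have hb2 : -6 ≤ (b : ℝ) * (1 + 2 * rho) := by linarith
  have hb3 : (b : ℝ) ≤ 3 := by nlinarith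
  have hb4 : -3 ≤ (b : ℝ) := by nlinarith
  have ha1 : (a : ℝ) ≤ 10 := by nlinarith
  have ha2 : -10 ≤ (a : ℝ) := by nlinarith
  refine ⟨(a, b), ⟨⟨by exact_mod_cast ha2, by exact_mod_cast ha1⟩, ⟨?_, ?_⟩⟩, hab.symm⟩
  · have : (-3 : ℤ) ≤ b := by exact_mod_cast hb4
    simp only; omega
  · have : b ≤ (3 : ℤ) := by exact_mod_cast hb3
    simp only; omega

end FiniteType

/-! ### Elementary mass estimates and the support -/

section Measure

variable {p : ℝ} {μ : Measure ℝ}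

namespace IsSelfSimilarMeasure

lemma pos_left (h : IsSelfSimilarMeasure goldenIFS (biasedProb p) μ) : 0 < p := h.prob_pos 0

lemma pos_right (h : IsSelfSimilarMeasure goldenIFS (biasedProb p) μ) : 0 < 1 - p := h.prob_pos 1

lemma real_eq (h : IsSelfSimilarMeasure goldenIFS (biasedProb p) μ) {E : Set ℝ}
    (hE : MeasurableSet E) :
    μ.real E = p * μ.real (goldenIFS 0 ⁻¹' E) + (1 - p) * μ.real (goldenIFS 1 ⁻¹' E) := by
  have := h.isProbabilityMeasure
  rw [Measure.real, h.invariant E hE, Fin.sum_univ_two, ENNReal.toReal_add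
    (ENNReal.mul_ne_top ENNReal.ofReal_ne_top (measure_ne_top _ _))
    (ENNReal.mul_ne_top ENNReal.ofReal_ne_top (measure_ne_top _ _)),
    ENNReal.toReal_mul, ENNReal.toReal_mul, ENNReal.toReal_ofReal (h.prob_pos 0).le,
    ENNReal.toReal_ofReal (h.prob_pos 1).le]
  rfl

/-- An upper bound for the measure of a set from supersets of its preimages. -/
lemma real_le (h : IsSelfSimilarMeasure goldenIFS (biasedProb p) μ) {E A B : Set ℝ}
    (hE : MeasurableSet E) (hA : goldenIFS 0 ⁻¹' E ⊆ A) (hB : goldenIFS 1 ⁻¹' E ⊆ B) :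
    μ.real E ≤ p * μ.real A + (1 - p) * μ.real B := by
  have := h.isProbabilityMeasure
  rw [h.real_eq hE]
  exact add_le_add (mul_le_mul_of_nonneg_left (measureReal_mono hA) h.pos_left.le)
    (mul_le_mul_of_nonneg_left (measureReal_mono hB) h.pos_right.le)

/-- A lower bound for the measure of a set from a subset of one of its preimages. -/
lemma le_real (h : IsSelfSimilarMeasure goldenIFS (biasedProb p) μ) {E A : Set ℝ}
    (hE : MeasurableSet E) (j : Fin 2) (hA : A ⊆ goldenIFS j ⁻¹' E) :
    biasedProb p j * μ.real A ≤ μ.real E := by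
  have := h.isProbabilityMeasure
  refine (mul_le_mul_of_nonneg_left (measureReal_mono hA) (h.prob_pos j).le).trans ?_
  rw [h.real_eq hE]
  have h0 := mul_nonneg h.pos_left.le (measureReal_nonneg (μ := μ) (s := goldenIFS 0 ⁻¹' E))
  have h1 := mul_nonneg h.pos_right.le (measureReal_nonneg (μ := μ) (s := goldenIFS 1 ⁻¹' E))
  fin_cases j
  · simpa [biasedProb] using h1
  · simpa [biasedProb] using h0

/-- Under both maps, preimages expand distances to `[0,1]` enough that the mass outside the
`ρt`-neighbourhood is at most that outside the `t`-neighbourhood. Iterating pushes the mass off to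
infinity. -/
lemma measure_compl_Icc_eq_zero_of_pos (h : IsSelfSimilarMeasure goldenIFS (biasedProb p) μ)
    {t : ℝ} (ht : 0 < t) : μ (Icc (-t) (1 + t))ᶜ = 0 := by
  have := h.isProbabilityMeasure
  have hρ := rho_pos
  have hρ1 := rho_lt_one
  have step (t : ℝ) : μ.real (Icc (-(rho * t)) (1 + rho * t))ᶜ ≤ μ.real (Icc (-t) (1 + t))ᶜ := by
    refine (h.real_le (A := (Icc (-t) (1 + t))ᶜ) (B := (Icc (-t) (1 + t))ᶜ)
      measurableSet_Icc.compl ?_ ?_).trans_eq (by ring) <;>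
    · refine fun x => mt fun hx => ?_
      simp only [goldenIFS_zero, goldenIFS_one, mem_Icc] at hx ⊢
      constructor <;> nlinarith [hx.1, hx.2]
  have iter (n : ℕ) : μ.real (Icc (-t) (1 + t))ᶜ
      ≤ μ.real (Icc (-(t / rho ^ n)) (1 + t / rho ^ n))ᶜ := by
    induction n with
    | zero => simp
    | succ n ih =>
      have := step (t / rho ^ (n + 1))
      rw [pow_succ', show rho * (t / (rho * rho ^ n)) = t / rho ^ n by field_simp] at this
      rw [pow_succ']
      exact ih.trans this
  have hgrow : Tendsto (fun n : ℕ => t / rho ^ n) atTop atTop := by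
    have := (tendsto_pow_atTop_atTop_of_one_lt ((one_lt_inv₀ hρ).2 hρ1)).const_mul_atTop ht
    simpa [div_eq_mul_inv] using this
  have hmono : Monotone (fun n : ℕ => t / rho ^ n) := fun m n hmn =>
    div_le_div_of_nonneg_left ht.le (pow_pos hρ _) (pow_le_pow_of_le_one hρ.le hρ1.le hmn)
  have hlim := tendsto_measure_iInter_atTop (μ := μ)
    (s := fun n : ℕ => (Icc (-(t / rho ^ n)) (1 + t / rho ^ n))ᶜ)
    (fun n => measurableSet_Icc.compl.nullMeasurableSet)
    (fun m n hmn => compl_subset_compl.2 (Icc_subset_Icc (neg_le_neg (hmono hmn))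
      (by linarith [hmono hmn]))) ⟨0, measure_ne_top _ _⟩
  have hempty : (⋂ n : ℕ, (Icc (-(t / rho ^ n)) (1 + t / rho ^ n))ᶜ) = ∅ := by
    refine eq_empty_of_forall_notMem fun x hx => ?_
    obtain ⟨n, hn⟩ := (hgrow.eventually_ge_atTop |x|).exists
    have := abs_le.1 hn
    exact mem_iInter.1 hx n ⟨by linarith, by linarith⟩
  rw [hempty, measure_empty] at hlim
  refine le_antisymm (ge_of_tendsto' hlim fun n => ?_) zero_le
  exact (ENNReal.toReal_le_toReal (measure_ne_top _ _) (measure_ne_top _ _)).1 (iter n)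

lemma measure_compl_Icc (h : IsSelfSimilarMeasure goldenIFS (biasedProb p) μ) :
    μ (Icc 0 1)ᶜ = 0 := by
  refine measure_mono_null (t := ⋃ n : ℕ, (Icc (-(1 / ((n : ℝ) + 1))) (1 + 1 / ((n : ℝ) + 1)))ᶜ)
    (fun x hx => ?_) (measure_iUnion_null fun n =>
      h.measure_compl_Icc_eq_zero_of_pos Nat.one_div_pos_of_nat)
  rw [mem_iUnion]
  by_contra! hc
  simp only [mem_compl_iff, not_not, mem_Icc] at hc
  have hlim := tendsto_one_div_add_atTop_nhds_zero_nat (𝕜 := ℝ)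
  refine hx ⟨?_, ?_⟩
  · have := hlim.neg
    rw [neg_zero] at this
    exact le_of_tendsto' this fun n => (hc n).1
  · have := hlim.const_add 1
    rw [add_zero] at this
    exact ge_of_tendsto' this fun n => (hc n).2

lemma real_eq_zero (h : IsSelfSimilarMeasure goldenIFS (biasedProb p) μ) {E : Set ℝ}
    (hE : E ⊆ (Icc 0 1)ᶜ) : μ.real E = 0 := by
  rw [Measure.real, measure_mono_null hE h.measure_compl_Icc, ENNReal.toReal_zero]

lemma real_Icc (h : IsSelfSimilarMeasure goldenIFS (biasedProb p) μ) : μ.real (Icc 0 1) = 1 := by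
  have := h.isProbabilityMeasure
  rw [← compl_compl (Icc (0 : ℝ) 1), probReal_compl_eq_one_sub measurableSet_Icc.compl,
    h.real_eq_zero subset_rfl, sub_zero]

/-- A power lower bound for the measures of balls. -/
lemma pow_le_real_ball (h : IsSelfSimilarMeasure goldenIFS (biasedProb p) μ) (hp : 1 / 2 < p)
    (n : ℕ) {x : ℝ} (hx : x ∈ Icc (0 : ℝ) 1) :
    (1 - p) ^ n ≤ μ.real (Metric.ball x (2 * rho ^ n)) := by
  have := h.isProbabilityMeasure
  induction n generalizing x with
  | zero =>
    rw [pow_zero, ← h.real_Icc]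
    refine measureReal_mono fun y hy => ?_
    rw [Metric.mem_ball, Real.dist_eq, abs_lt]
    constructor <;> linarith [hx.1, hx.2, hy.1, hy.2]
  | succ n ih =>
    have hx' := hx
    rw [isSelfSimilarSet_goldenIFS.2.2, mem_iUnion] at hx'
    obtain ⟨j, y, hy, rfl⟩ := hx'
    have hj : 1 - p ≤ biasedProb p j := by
      fin_cases j <;> simp [biasedProb]; linarith
    calc (1 - p) ^ (n + 1) = (1 - p) * (1 - p) ^ n := pow_succ' _ _
      _ ≤ biasedProb p j * μ.real (Metric.ball y (2 * rho ^ n)) :=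
        mul_le_mul hj (ih hy) (pow_pos h.pos_right _).le (h.prob_pos j).le
      _ ≤ _ := by
        refine h.le_real Metric.isOpen_ball.measurableSet j fun z hz => ?_
        rw [Metric.mem_ball, Real.dist_eq] at hz
        rw [mem_preimage, Metric.mem_ball, Real.dist_eq, goldenIFS_apply, goldenIFS_apply,
          add_sub_add_right_eq_sub, ← mul_sub, abs_mul, abs_of_pos rho_pos, pow_succ']
        nlinarith [rho_pos]

theorem support_eq (h : IsSelfSimilarMeasure goldenIFS (biasedProb p) μ) (hp : 1 / 2 < p) :
    μ.support = Icc 0 1 := by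
  have := h.isProbabilityMeasure
  refine Subset.antisymm (Measure.support_subset_of_isClosed isClosed_Icc h.measure_compl_Icc)
    fun x hx => ?_
  refine Metric.nhds_basis_ball.mem_measureSupport.2 fun r hr => ?_
  obtain ⟨n, hn⟩ := exists_pow_lt_of_lt_one (half_pos hr) rho_lt_one
  have h1 := (pow_pos h.pos_right n).trans_le (h.pow_le_real_ball hp n hx)
  have h2 : 0 < μ.real (Metric.ball x r) :=
    h1.trans_le (measureReal_mono (Metric.ball_subset_ball (by linarith)))
  exact (ENNReal.toReal_pos_iff.1 h2).1

lemma real_ball_pos (h : IsSelfSimilarMeasure goldenIFS (biasedProb p) μ) (hp : 1 / 2 < p)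
    {x r : ℝ} (hx : x ∈ Icc (0 : ℝ) 1) (hr : 0 < r) : 0 < μ.real (Metric.ball x r) := by
  have := h.isProbabilityMeasure
  rw [← h.support_eq hp] at hx
  exact ENNReal.toReal_pos (Metric.nhds_basis_ball.mem_measureSupport.1 hx r hr).ne'
    (measure_ne_top _ _)

/-! ### Finiteness of the dimension for fixed `δ` -/

theorem upperPhiDim_lt_top (h : IsSelfSimilarMeasure goldenIFS (biasedProb p) μ) (hp : 1 / 2 < p)
    {δ : ℝ} (hδ : 0 < δ) : upperPhiDim (fun _ => δ) μ < ⊤ := by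
  have := h.isProbabilityMeasure
  have hq := h.pos_right
  have hlogρ := Real.log_neg rho_pos rho_lt_one
  set s : ℝ := Real.log (1 - p) / Real.log rho with hs
  have hs0 : 0 < s := div_pos_of_neg_of_neg (Real.log_neg hq (by linarith)) hlogρ
  have hρs : rho ^ s = 1 - p := by
    rw [Real.rpow_def_of_pos rho_pos, hs, mul_div_cancel₀ _ hlogρ.ne, Real.exp_log hq]
  -- Balls have mass at least a constant times `r^s`, and `R/r ≥ r^(-δ/(1+δ))`; this exponent turns
  -- the latter into `r^(-s)`.
  suffices hα : s * (1 + δ) / δ ∈ upperPhiExponents (fun _ => δ) μ from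
    (sInf_le (mem_image_of_mem _ hα)).trans_lt (EReal.coe_lt_top _)
  refine ⟨1, one_pos, 2 ^ s / (1 - p), by positivity, fun R hR r hr hrR _ _ x hx => ?_⟩
  rw [h.support_eq hp] at hx
  have hR0 := hR.1
  have hr1 : r < 1 := hrR.trans (Real.rpow_lt_one hR.1.le hR.2 (by linarith))
  obtain ⟨n, hn1, hn2⟩ := exists_nat_pow_near_of_lt_one (half_pos hr) (by linarith) rho_pos
    rho_lt_one
  have hball : (1 - p) * (r / 2) ^ s ≤ μ.real (Metric.ball x r) :=
    calc (1 - p) * (r / 2) ^ s ≤ (1 - p) * (rho ^ n) ^ s := by gcongr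
      _ = (1 - p) ^ (n + 1) := by
        rw [← Real.rpow_natCast, ← Real.rpow_mul rho_pos.le, mul_comm (n : ℝ),
          Real.rpow_mul rho_pos.le, hρs, Real.rpow_natCast, pow_succ']
      _ ≤ μ.real (Metric.ball x (2 * rho ^ (n + 1))) := h.pow_le_real_ball hp _ hx
      _ ≤ _ := measureReal_mono (Metric.ball_subset_ball (by linarith))
  have hRr : r ^ (-s) ≤ (R / r) ^ (s * (1 + δ) / δ) := by
    have h1 : r ^ (1 / (1 + δ)) ≤ R := by
      calc r ^ (1 / (1 + δ)) ≤ (R ^ (1 + δ)) ^ (1 / (1 + δ)) := by gcongr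
        _ = R := by
          rw [← Real.rpow_mul hR0.le, mul_one_div_cancel (by positivity), Real.rpow_one]
    have h2 : r ^ (1 / (1 + δ) - 1) ≤ R / r := by
      rw [Real.rpow_sub_one hr.ne']
      gcongr
    calc r ^ (-s) = (r ^ (1 / (1 + δ) - 1)) ^ (s * (1 + δ) / δ) := by
          rw [← Real.rpow_mul hr.le]
          congr 1
          field_simp
          ring
      _ ≤ _ := by gcongr
  calc μ.real (Metric.ball x R) / μ.real (Metric.ball x r)
      ≤ 1 / ((1 - p) * (r / 2) ^ s) := by
        gcongr
        exact measureReal_le_one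
    _ = 2 ^ s / (1 - p) * r ^ (-s) := by
        rw [Real.div_rpow hr.le two_pos.le, Real.rpow_neg hr.le]
        field_simp
    _ ≤ _ := by gcongr

/-! ### Asymmetry of the measure at `ρ²` -/

lemma pow_le_real_Icc (h : IsSelfSimilarMeasure goldenIFS (biasedProb p) μ) (n : ℕ) :
    p ^ n ≤ μ.real (Icc 0 (rho ^ n)) := by
  induction n with
  | zero => simp [h.real_Icc]
  | succ n ih =>
    rw [pow_succ']
    refine (mul_le_mul_of_nonneg_left ih h.pos_left.le).trans
      (h.le_real measurableSet_Icc 0 fun x hx => ?_)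
    rw [mem_preimage, goldenIFS_zero, pow_succ']
    exact ⟨mul_nonneg rho_pos.le hx.1, mul_le_mul_of_nonneg_left hx.2 rho_pos.le⟩

/-- The measure of an interval to the right of `ρ²`. -/
lemma le_real_Icc_rho_sq (h : IsSelfSimilarMeasure goldenIFS (biasedProb p) μ) (n : ℕ) :
    (1 - p) * p ^ n ≤ μ.real (Icc (rho ^ 2) (rho ^ 2 + rho ^ (n + 1))) := by
  refine (mul_le_mul_of_nonneg_left (h.pow_le_real_Icc n) h.pos_right.le).trans
    (h.le_real measurableSet_Icc 1 fun x hx => ?_)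
  rw [mem_preimage, goldenIFS_one, pow_succ' rho n, rho_sq]
  have := mul_nonneg rho_pos.le hx.1
  have := mul_le_mul_of_nonneg_left hx.2 rho_pos.le
  constructor <;> linarith

/-- Within distance `ρ²` of 1 only `S₁` contributes, since `S₀` maps `[0,1]` onto `[0,ρ]` and `ρ = 1
- ρ²`. Each further factor `ρ` in length therefore costs a factor `1 - p`. -/
lemma real_Ioo_one_le (h : IsSelfSimilarMeasure goldenIFS (biasedProb p) μ) (n : ℕ) :
    μ.real (Ioo (1 - rho ^ (n + 1)) 1) ≤ (1 - p) ^ n := by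
  have := h.isProbabilityMeasure
  have hρ := rho_pos
  induction n with
  | zero => simp
  | succ n ih =>
    have hn : rho ^ (n + 1 + 1) ≤ rho ^ 2 :=
      pow_le_pow_of_le_one hρ.le rho_lt_one.le (by omega)
    have := h.real_le (E := Ioo (1 - rho ^ (n + 1 + 1)) 1) (A := Ioi 1)
      (B := Ioo (1 - rho ^ (n + 1)) 1) measurableSet_Ioo (fun x hx => ?_) (fun x hx => ?_)
    · rw [h.real_eq_zero (E := Ioi 1) fun x hx hx' => absurd hx'.2 (not_le.2 hx), mul_zero, zero_add] at this
      rw [pow_succ' (1 - p)]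
      exact this.trans (mul_le_mul_of_nonneg_left ih h.pos_right.le)
    · have := hx.1
      rw [goldenIFS_zero] at this
      rw [mem_Ioi]
      nlinarith [rho_sq]
    · rw [mem_preimage, goldenIFS_one, pow_succ' _ (n + 1)] at hx
      constructor <;> nlinarith [hx.1, hx.2]

/-- The recursion for the measures of intervals to the left of `ρ²`. -/
lemma real_Ioo_rho_sq_succ_le (h : IsSelfSimilarMeasure goldenIFS (biasedProb p) μ) (n : ℕ) :
    μ.real (Ioo (rho ^ 2 - rho ^ (n + 2)) (rho ^ 2)) ≤
      p ^ 2 * μ.real (Ioo (1 - rho ^ n) 1)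
        + p * (1 - p) * μ.real (Ioo (rho ^ 2 - rho ^ n) (rho ^ 2)) := by
  have hρ := rho_pos
  have hρ2 := rho_sq
  have h1 := h.real_le (E := Ioo (rho ^ 2 - rho ^ (n + 2)) (rho ^ 2))
    (A := Ioo (rho - rho ^ (n + 1)) rho) (B := Iio 0) measurableSet_Ioo
    (fun x hx => ?_) (fun x hx => ?_)
  · have h2 := h.real_le (E := Ioo (rho - rho ^ (n + 1)) rho) (A := Ioo (1 - rho ^ n) 1)
      (B := Ioo (rho ^ 2 - rho ^ n) (rho ^ 2)) measurableSet_Ioo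
      (fun x hx => ?_) (fun x hx => ?_)
    · rw [h.real_eq_zero (E := Iio 0) fun x hx hx' => absurd hx'.1 (not_le.2 hx), mul_zero, add_zero] at h1
      refine h1.trans ((mul_le_mul_of_nonneg_left h2 h.pos_left.le).trans_eq (by ring))
    · rw [mem_preimage, goldenIFS_zero, pow_succ'] at hx
      constructor <;> nlinarith [hx.1, hx.2]
    · rw [mem_preimage, goldenIFS_one, pow_succ' _ n] at hx
      constructor <;> nlinarith [hx.1, hx.2]
  · rw [mem_preimage, goldenIFS_zero, pow_succ' _ (n + 1)] at hx
    constructor <;> nlinarith [hx.1, hx.2]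
  · have := hx.2
    rw [goldenIFS_one] at this
    rw [mem_Iio]
    nlinarith

/-- The measure of an interval to the left of `ρ²` is much smaller than that of the adjacent
interval of the same length to the right. -/
lemma exists_real_Ioo_rho_sq_le (h : IsSelfSimilarMeasure goldenIFS (biasedProb p) μ)
    (hp : 1 / 2 < p) : ∃ C > 0, ∀ m : ℕ,
      μ.real (Ioo (rho ^ 2 - rho ^ (2 * m + 1)) (rho ^ 2)) ≤ C * (p * (1 - p)) ^ m := by
  have := h.isProbabilityMeasure
  have hp0 := h.pos_left
  have hq := h.pos_right
  have hpq : 0 < p - (1 - p) := by linarith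
  -- `-E (1-p)^(2m)` is a particular solution of the recursion with its forcing term `p²
  -- (1-p)^(2m)`. Subtracting it in `key` makes the induction close exactly; `p > 1/2` gives `E >
  -- 0`.
  set E : ℝ := p ^ 2 / ((1 - p) * (p - (1 - p))) with hE
  have hE0 : 0 < E := by positivity
  have hEeq : E * (p * (1 - p)) - E * (1 - p) ^ 2 = p ^ 2 := by
    rw [hE]; field_simp
  have key (m : ℕ) : μ.real (Ioo (rho ^ 2 - rho ^ (2 * m + 1)) (rho ^ 2))
      ≤ (1 + E) * (p * (1 - p)) ^ m - E * (1 - p) ^ (2 * m) := by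
    induction m with
    | zero => simp
    | succ m ih =>
      have h1 := h.real_Ioo_rho_sq_succ_le (2 * m + 1)
      have h2 := mul_le_mul_of_nonneg_left (h.real_Ioo_one_le (2 * m)) (sq_nonneg p)
      have h3 := mul_le_mul_of_nonneg_left ih (mul_pos hp0 hq).le
      rw [show 2 * (m + 1) + 1 = 2 * m + 1 + 2 by ring]
      refine (h1.trans (add_le_add h2 h3)).trans_eq ?_
      linear_combination (-(1 - p) ^ (2 * m)) * hEeq
  refine ⟨1 + E, by linarith, fun m => (key m).trans (sub_le_self _ ?_)⟩
  positivity

/-! ### The lower bound and the quasi-Assouad dimension -/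

lemma exists_mul_pow_le_of_mem_upperPhiExponents
    (h : IsSelfSimilarMeasure goldenIFS (biasedProb p) μ) (hp : 1 / 2 < p) {δ α : ℝ} (hδ : 0 < δ)
    (hα : α ∈ upperPhiExponents (fun _ => δ) μ) :
    ∃ C : ℝ, ∀ᶠ m : ℕ in atTop, (p / (1 - p)) ^ m ≤ C * (rho ^ (-(2 * δ * α))) ^ m := by
  have := h.isProbabilityMeasure
  have hp0 := h.pos_left
  have hq := h.pos_right
  have hρ := rho_pos
  obtain ⟨C₁, hC₁, C₂, hC₂, H⟩ := hα
  obtain ⟨C, hC, hleft⟩ := h.exists_real_Ioo_rho_sq_le hp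
  refine ⟨C / (1 - p) * (C₂ * (2 * (2 * rho) ^ (-δ)) ^ α), ?_⟩
  have hlim : Tendsto (fun m : ℕ => 2 * rho ^ (2 * m + 1)) atTop (𝓝 0) := by
    have h1 : Tendsto (fun m : ℕ => 2 * m + 1) atTop atTop :=
      tendsto_atTop_mono (fun m => by simp only [id]; omega) tendsto_id
    simpa using ((tendsto_pow_atTop_nhds_zero_of_lt_one hρ.le rho_lt_one).comp h1).const_mul 2
  have hlim' : Tendsto (fun m : ℕ => 2 * (2 * rho ^ (2 * m + 1)) ^ δ) atTop (𝓝 0) := by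
    have := (hlim.rpow_const (p := δ) (Or.inr hδ.le)).const_mul 2
    simpa [Real.zero_rpow hδ.ne'] using this
  filter_upwards [hlim.eventually_lt_const one_pos, hlim.eventually_le_const hC₁,
    hlim'.eventually_le_const one_pos] with m hm1 hm2 hm3
  set ε : ℝ := rho ^ (2 * m + 1) with hε
  have hε0 : 0 < ε := pow_pos hρ _
  have hερ : ε ≤ rho := pow_le_of_le_one hρ.le rho_lt_one.le (by omega)
  have hR : 0 < 2 * ε := by positivity
  have hRδ : (2 * ε) ^ (1 + δ) = 2 * ε * (2 * ε) ^ δ := by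
    rw [Real.rpow_add hR, Real.rpow_one]
  have hRδ0 : 0 < (2 * ε) ^ δ := by positivity
  -- Halving makes `r < R^(1+δ)` strict for `R = 2ε`. For large `m` also `r ≤ ε/2`, so around `ρ² -
  -- ε/2` the small ball lies in `(ρ² - ε, ρ²)`, while the large one contains `[ρ², ρ² + ε]`.
  set r : ℝ := (2 * ε) ^ (1 + δ) / 2 with hr
  have hr0 : 0 < r := by positivity
  have hrε : r ≤ ε / 2 := by
    rw [hr, hRδ]; nlinarith
  have hx : rho ^ 2 - ε / 2 ∈ Icc (0 : ℝ) 1 := by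
    have := half_lt_rho
    have := rho_lt_one
    constructor <;> nlinarith
  have hH := H (2 * ε) ⟨hR, hm1⟩ r hr0 (half_lt_self (by positivity))
    (by rw [hRδ]; nlinarith) hm2 _ (by rw [h.support_eq hp]; exact hx)
  have hbig : (1 - p) * p ^ (2 * m) ≤ μ.real (Metric.ball (rho ^ 2 - ε / 2) (2 * ε)) := by
    refine (h.le_real_Icc_rho_sq (2 * m)).trans (measureReal_mono fun y hy => ?_)
    rw [← hε] at hy
    rw [Metric.mem_ball, Real.dist_eq, abs_lt]
    constructor <;> linarith [hy.1, hy.2]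
  have hsmall : μ.real (Metric.ball (rho ^ 2 - ε / 2) r) ≤ C * (p * (1 - p)) ^ m := by
    refine (measureReal_mono fun y hy => ?_).trans (hleft m)
    rw [Metric.mem_ball, Real.dist_eq, abs_lt] at hy
    rw [← hε]
    constructor <;> linarith [hy.1, hy.2]
  have hratio : (1 - p) * p ^ (2 * m) / (C * (p * (1 - p)) ^ m) ≤ C₂ * (2 * ε / r) ^ α := by
    refine le_trans ?_ hH
    have := h.real_ball_pos hp hx hr0
    gcongr
  have hRr : (2 * ε / r) ^ α = (2 * (2 * rho) ^ (-δ)) ^ α * (rho ^ (-(2 * δ * α))) ^ m := by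
    have h1 : 2 * ε / r = 2 * (2 * rho) ^ (-δ) * rho ^ (-(2 * δ) * m) := by
      have h2 : 2 * ε = 2 * rho * rho ^ (2 * (m : ℝ)) := by
        rw [hε, pow_succ', pow_mul, Real.rpow_mul hρ.le, Real.rpow_natCast]
        norm_num
        ring
      have h3 : 2 * ε / r = 2 * (2 * ε) ^ (-δ) := by
        rw [hr, hRδ, Real.rpow_neg hR.le]
        field_simp
      rw [h3, h2, Real.mul_rpow (by positivity) (by positivity), ← Real.rpow_mul hρ.le,
        show 2 * (m : ℝ) * -δ = -(2 * δ) * m by ring]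
      ring
    rw [h1, Real.mul_rpow (by positivity) (by positivity), ← Real.rpow_mul hρ.le,
      ← Real.rpow_natCast, ← Real.rpow_mul hρ.le]
    congr 2
    ring
  rw [hRr, ← mul_assoc] at hratio
  have hident : (p / (1 - p)) ^ m
      = C / (1 - p) * ((1 - p) * p ^ (2 * m) / (C * (p * (1 - p)) ^ m)) := by
    rw [div_pow, mul_pow, two_mul, pow_add]
    field_simp
  rw [hident, mul_assoc (C / (1 - p))]
  gcongr

theorem le_upperPhiDim (h : IsSelfSimilarMeasure goldenIFS (biasedProb p) μ) (hp : 1 / 2 < p)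
    {δ : ℝ} (hδ : 0 < δ) :
    ((Real.log (p / (1 - p)) / (2 * δ * |Real.log rho|) : ℝ) : EReal)
      ≤ upperPhiDim (fun _ => δ) μ := by
  refine le_sInf ?_
  rintro _ ⟨α, hα, rfl⟩
  rw [EReal.coe_le_coe_iff]
  have hlogρ := Real.log_neg rho_pos rho_lt_one
  have hpq : 0 < p / (1 - p) := div_pos h.pos_left h.pos_right
  rw [abs_of_neg hlogρ, div_le_iff₀ (mul_pos (by positivity) (neg_pos.2 hlogρ))]
  obtain ⟨C, hC⟩ := h.exists_mul_pow_le_of_mem_upperPhiExponents hp hδ hα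
  set y : ℝ := rho ^ (-(2 * δ * α)) with hy
  have hy0 : 0 < y := Real.rpow_pos_of_pos rho_pos _
  suffices hle : p / (1 - p) ≤ y by
    have := Real.log_le_log hpq hle
    rw [hy, Real.log_rpow rho_pos] at this
    linarith
  -- Otherwise the quotient of the two geometric sequences would be unbounded, against the constant
  -- `C` independent of `m`.
  by_contra! hlt
  have hlim := tendsto_pow_atTop_atTop_of_one_lt ((one_lt_div hy0).2 hlt)
  obtain ⟨m, hm1, hm2⟩ := (hC.and (hlim.eventually_gt_atTop C)).exists
  rw [div_pow, lt_div_iff₀ (pow_pos hy0 m)] at hm2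
  exact hm2.not_ge hm1

theorem hasQuasiAssouadDim_top (h : IsSelfSimilarMeasure goldenIFS (biasedProb p) μ)
    (hp : 1 / 2 < p) : HasQuasiAssouadDim μ ⊤ := by
  have hlogρ := Real.log_neg rho_pos rho_lt_one
  have hL : 0 < Real.log (p / (1 - p)) / (2 * |Real.log rho|) := by
    refine div_pos (Real.log_pos ?_) (by rw [abs_of_neg hlogρ]; linarith)
    rw [one_lt_div h.pos_right]
    linarith
  have hδ : Tendsto (fun θ : ℝ => 1 / θ - 1) (𝓝[<] 1) (𝓝[>] 0) := by
    refine tendsto_nhdsWithin_iff.2 ⟨?_, ?_⟩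
    · have : ContinuousAt (fun θ : ℝ => 1 / θ - 1) 1 := by fun_prop (disch := norm_num)
      simpa using this.tendsto.mono_left nhdsWithin_le_nhds
    · filter_upwards [Ioo_mem_nhdsLT (zero_lt_one (α := ℝ))] with θ hθ
      exact sub_pos.2 ((one_lt_div hθ.1).2 hθ.2)
  have hlim : Tendsto (fun θ : ℝ =>
      Real.log (p / (1 - p)) / (2 * |Real.log rho|) * (1 / θ - 1)⁻¹) (𝓝[<] 1) atTop :=
    (tendsto_inv_nhdsGT_zero.comp hδ).const_mul_atTop hL
  refine EReal.tendsto_nhds_top_iff_real.2 fun M => ?_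
  filter_upwards [hlim.eventually_gt_atTop M, hδ self_mem_nhdsWithin] with θ hM hθ
  refine lt_of_lt_of_le (EReal.coe_lt_coe_iff.2 hM) ((le_of_eq ?_).trans (h.le_upperPhiDim hp hθ))
  congr 1
  rw [← div_eq_mul_inv, div_div, mul_right_comm 2]

end IsSelfSimilarMeasure

end Measure

end BernoulliConv

open BernoulliConv in
theorem mainTheorem7 (p : ℝ) (hp : 1 / 2 < p) (hp1 : p < 1) :
    (∃! μ : Measure ℝ, IsSelfSimilarMeasure goldenIFS (biasedProb p) μ) ∧
    ∀ μ : Measure ℝ, IsSelfSimilarMeasure goldenIFS (biasedProb p) μ →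
      IsEquicontractive goldenIFS rho ∧
      IsFiniteType goldenIFS rho ∧
      μ.support = Icc (0 : ℝ) 1 ∧
      (∀ δ : ℝ, 0 < δ →
        ((Real.log (p / (1 - p)) / (2 * δ * |Real.log rho|) : ℝ) : EReal)
            ≤ upperPhiDim (fun _ => δ) μ ∧
          upperPhiDim (fun _ => δ) μ < ⊤) ∧
      HasQuasiAssouadDim μ ⊤ := by
  have hp0 : 0 < p := by linarith
  obtain ⟨μ, hμ⟩ := exists_isSelfSimilarMeasure hp0 hp1
  exact ⟨⟨μ, hμ, fun ν hν => hν.unique hp0.le hp1.le hμ⟩, fun ν hν =>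
    ⟨isEquicontractive_goldenIFS, isFiniteType_goldenIFS, hν.support_eq hp,
      fun δ hδ => ⟨hν.le_upperPhiDim hp hδ, hν.upperPhiDim_lt_top hp hδ⟩,
      hν.hasQuasiAssouadDim_top hp⟩⟩
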